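/- Let $\Gamma$ be a group and $R$ a ring with $1$. A strongly $\Gamma$-graded ring $R(\Gamma)$ over $R$ is a ring with a decomposition $R(\Gamma)=\bigoplus_{g\in\Gamma}S_g$ into additive subgroups such that $S_gS_h=S_{gh}$ for all $g,h\in\Gamma$ (where $S_gS_h$ is the additive subgroup generated by the products) and $S_1=R$. For a subgroup $H\le\Gamma$ put $R(H)=\bigoplus_{h\in H}S_h$, a subring of $R(\Gamma)$. For $x\in\Gamma$ consider the conditions (M1) $\langle x\rangle\cap H\neq\{e\}$; (M2) the order of $x$ is finite and invertible in $R$. Moore's conjecture is said to hold for $\Gamma$ if, for every ring $R$ and every subgroup $H$ of finite index in $\Gamma$ such that every nontrivial $x\in\Gamma$ satisfies (M1) or (M2), the following holds: for every strongly $\Gamma$-graded ring $R(\Gamma)$ over $R$, every $R(\Gamma)$-module that is projective over $R(H)$ is projective over $R(\Gamma)$. **Theorem 1.2.** Let $G$ be a group. If Moore's conjecture holds for every finitely generated subgroup of $G$, then it holds for $G$. The same is true if "Moore's conjecture holds for $\Gamma$" is understood in the weaker sense in which only those pairs $(\Gamma,H)$ are considered for which every nontrivial $x\in\Gamma$ satisfies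 (M1), with $R$ still arbitrary. -/

import Mathlib

universe w u v t

/-- A strongly `Γ`-graded ring `R(Γ)` over `R`: a ring `S` together with additive subgroups `S_g`
(`g ∈ Γ`) such that `S = ⨁_g S_g` and `S_g S_h = S_{gh}`, where `S_g S_h` is the additive subgroup
generated by the products, and such that the identity component `S_1` is (a copy of) `R`. -/
structure StronglyGradedRing (Γ : Type*) [Group Γ] (R : Type*) [Ring R] (S : Type*) [Ring S] where
  /-- the homogeneous component `S_g` -/
  component : Γ → AddSubgroup S
  isInternal : open scoped Classical in DirectSum.IsInternal component
  closure_mul_eq : ∀ g h : Γ,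
    AddSubgroup.closure (Set.image2 (fun a b : S => a * b) (component g) (component h)) =
      component (g * h)
  /-- the inclusion of the coefficient ring -/
  coeff : R →+* S
  coeff_injective : Function.Injective coeff
  range_coeff : (coeff.range : Set S) = component 1

namespace StronglyGradedRing

variable {Γ : Type*} [Group Γ] {R : Type*} [Ring R] {S : Type*} [Ring S]

theorem one_mem_component (A : StronglyGradedRing Γ R S) : (1 : S) ∈ A.component 1 := by
  have h : (1 : S) ∈ (A.coeff.range : Set S) := ⟨1, map_one _⟩
  rw [A.range_coeff] at h
  exact h

theorem mul_mem_component (A : StronglyGradedRing Γ R S) {g h : Γ} {a b : S}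
    (ha : a ∈ A.component g) (hb : b ∈ A.component h) : a * b ∈ A.component (g * h) := by
  rw [← A.closure_mul_eq]
  exact AddSubgroup.subset_closure ⟨a, ha, b, hb, rfl⟩

theorem mul_mem_iSup_component (A : StronglyGradedRing Γ R S) (H : Subgroup Γ) {a b : S}
    (ha : a ∈ ⨆ h : H, A.component h) (hb : b ∈ ⨆ h : H, A.component h) :
    a * b ∈ ⨆ h : H, A.component h := by
  induction ha using AddSubgroup.iSup_induction' with
  | hp i x hx =>
    induction hb using AddSubgroup.iSup_induction' with
    | hp j y hy =>
      exact AddSubgroup.mem_iSup_of_mem (i * j) (A.mul_mem_component hx hy)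
    | h1 => simp
    | hadd y z _ _ ihy ihz => rw [mul_add]; exact add_mem ihy ihz
  | h1 => simp
  | hadd x z _ _ ihx ihz => rw [add_mul]; exact add_mem ihx ihz

/-- The subring `R(H) = ⨁_{h ∈ H} S_h` of `R(Γ)`. -/
def restrict (A : StronglyGradedRing Γ R S) (H : Subgroup Γ) : Subring S :=
  { (⨆ h : H, A.component h : AddSubgroup S) with
    one_mem' := AddSubgroup.mem_iSup_of_mem (1 : H) A.one_mem_component
    mul_mem' := fun ha hb => A.mul_mem_iSup_component H ha hb }

end StronglyGradedRing

/-- Condition `M1` for the element `x` and the subgroup `H`: `⟨x⟩ ∩ H ≠ {e}`. -/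
def MooreM1 {Γ : Type*} [Group Γ] (H : Subgroup Γ) (x : Γ) : Prop :=
  Subgroup.zpowers x ⊓ H ≠ ⊥

/-- Condition `M2` for the element `x` and the ring `R`: the order of `x` is finite and invertible
in `R`. -/
def MooreM2 {Γ : Type*} [Group Γ] (R : Type*) [Ring R] (x : Γ) : Prop :=
  IsOfFinOrder x ∧ IsUnit (orderOf x : R)

/-- The conclusion of Moore's conjecture for `(Γ, H, R)`: for every strongly graded ring
`S = R(Γ)` over `R`, every (left) `R(Γ)`-module that is projective over `R(H)` is projective over
`R(Γ)`. -/
def MooreConclusion {Γ : Type w} [Group Γ] (H : Subgroup Γ)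
    (R : Type u) [Ring R] : Prop :=
  ∀ (S : Type v) [Ring S] (A : StronglyGradedRing Γ R S) (M : Type t) [AddCommGroup M] [Module S M],
    Module.Projective (A.restrict H) M → Module.Projective S M

/-- Moore's conjecture holds for the triple `(Γ, H, R)`: if every nontrivial `x ∈ Γ` satisfies
`M1` or `M2`, then the conclusion holds for `(Γ, H, R)`. -/
def MooreConjectureTriple {Γ : Type w} [Group Γ] (H : Subgroup Γ)
    (R : Type u) [Ring R] : Prop :=
  (∀ x : Γ, x ≠ 1 → MooreM1 H x ∨ MooreM2 R x) → MooreConclusion.{w, u, v, t} H R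

/-- Moore's conjecture holds for the group `Γ`: it holds for `(Γ, H, R)` for every subgroup `H` of
finite index and every ring `R`. -/
def MooreConjecture (Γ : Type w) [Group Γ] : Prop :=
  ∀ H : Subgroup Γ, H.FiniteIndex → ∀ (R : Type u) [Ring R],
    MooreConjectureTriple.{w, u, v, t} H R

/-- Moore's conjecture holds for the pair `(Γ, H)`: if every nontrivial `x ∈ Γ` satisfies `M1`,
then the conclusion holds for `(Γ, H, R)` for every ring `R`. -/
def MooreConjecturePair {Γ : Type w} [Group Γ] (H : Subgroup Γ) : Prop :=
  (∀ x : Γ, x ≠ 1 → MooreM1 H x) → ∀ (R : Type u) [Ring R], MooreConclusion.{w, u, v, t} H R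

/-- Moore's conjecture holds for the group `Γ` in the sense of pairs: it holds for `(Γ, H)` for
every subgroup `H` of finite index. -/
def MooreConjectureOfPairs (Γ : Type w) [Group Γ] : Prop :=
  ∀ H : Subgroup Γ, H.FiniteIndex → MooreConjecturePair.{w, u, v, t} H

/-!
Let `H` have finite index in `G` and let `M` be an `R(G)`-module that is projective over `R(H)`. For
every finitely generated `Γ ≤ G` the ring `R(H ∩ Γ)` sits in `R(H)`, which is projective over it
(`StronglyGradedRing.projective_restrict_of_le`), so the hypothesis on `Γ` makes `M` projective over
`R(Γ)`. It remains to pass from finitely generated subgroups to all of `G`, by transfinite induction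
on the cardinality of a generating set (`StronglyGradedRing.projective_restrict_closure`).

A subgroup with an infinite generating set is the union of a well-ordered continuous chain of
subgroups `Γ_i` with smaller generating sets, so `M` is projective over each `R(Γ_i)`, and each
induced module `R(Γ) ⊗_{R(Γ_i)} M` is projective. In terms of the free `R(Γ)`-module `F` on the set
`M`, the kernel `N_i` of `F → R(Γ) ⊗_{R(Γ_i)} M` is a direct summand
(`exists_isProj_inducedRelations`). The `N_i` form a continuous chain whose union is the kernel of
`F → M`, so by Auslander's argument this kernel is projective
(`Submodule.projective_iSup_of_isProj`), and `M` has projective dimension at most one.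

Finally, a module of projective dimension at most one over `R(Γ)` that is projective over `R(H ∩ Γ)`
is projective (`StronglyGradedRing.projective_of_projective_ker`): the kernel of `F → M` is a
projective module, hence its identity is a trace from `R(H ∩ Γ)`, and averaging an
`R(H ∩ Γ)`-linear retraction of `F` onto the kernel gives an `R(Γ)`-linear one. Conjugation by `g`,
which the trace requires, is available in a strongly graded ring because `1 ∈ S_g S_{g⁻¹}`.
-/

namespace StronglyGradedRing

variable {Γ : Type*} [Group Γ] {R : Type*} [Ring R] {S : Type*} [Ring S]

/-! ### Homogeneous components and partitions of unity -/

theorem component_le_restrict (A : StronglyGradedRing Γ R S) {K : Subgroup Γ} {g : Γ} (hg : g ∈ K)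
    {s : S} (hs : s ∈ A.component g) : s ∈ A.restrict K :=
  AddSubgroup.mem_iSup_of_mem (⟨g, hg⟩ : K) hs

open scoped Classical in
theorem bijective_coeAddMonoidHom (A : StronglyGradedRing Γ R S) :
    Function.Bijective (DirectSum.coeAddMonoidHom A.component) :=
  A.isInternal

/-- An additive property of elements of `R(Γ)` may be checked on homogeneous elements. -/
theorem homogeneous_induction (A : StronglyGradedRing Γ R S) {p : S → Prop}
    (hom : ∀ g, ∀ s ∈ A.component g, p s) (zero : p 0) (add : ∀ s t, p s → p t → p (s + t))
    (s : S) : p s := by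
  classical
  obtain ⟨x, rfl⟩ := A.bijective_coeAddMonoidHom.surjective s
  induction x using DirectSum.induction_on with
  | zero => simpa using zero
  | of i x => simpa using hom i _ x.2
  | add x y hx hy => rw [map_add]; exact add _ _ hx hy

/-- An additive property of elements of `R(K)` may be checked on homogeneous elements. -/
theorem restrict_induction (A : StronglyGradedRing Γ R S) {K : Subgroup Γ} {p : S → Prop}
    (hom : ∀ g ∈ K, ∀ s ∈ A.component g, p s) (zero : p 0)
    (add : ∀ s t, p s → p t → p (s + t)) {s : S} (hs : s ∈ A.restrict K) : p s :=
  AddSubgroup.iSup_induction (fun h : K => A.component h) (C := p) hs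
    (fun g s hs => hom g g.2 s hs) zero add

theorem restrict_mono (A : StronglyGradedRing Γ R S) {K L : Subgroup Γ} (h : K ≤ L) :
    A.restrict K ≤ A.restrict L := fun _ hs => A.restrict_induction
  (p := fun s => s ∈ A.restrict L) (fun _ hg _ hs => A.component_le_restrict (h hg) hs)
  (zero_mem _) (fun _ _ => add_mem) hs

theorem restrict_top (A : StronglyGradedRing Γ R S) : A.restrict ⊤ = ⊤ :=
  eq_top_iff.2 fun s _ => A.homogeneous_induction
    (fun _ _ hs => A.component_le_restrict (Subgroup.mem_top _) hs) (zero_mem _)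
    (fun _ _ => add_mem) s

open scoped Classical in
/-- The additive projection of `R(Γ) = ⨁ S_g` onto the sum of the components `S_g`, `g ∈ X`, that
kills the other components. -/
noncomputable def projOn (A : StronglyGradedRing Γ R S) (X : Set Γ) : S →+ S :=
  (DirectSum.toAddMonoid fun g => if g ∈ X then (A.component g).subtype else 0).comp
    (AddEquiv.ofBijective (DirectSum.coeAddMonoidHom A.component)
      A.bijective_coeAddMonoidHom).symm.toAddMonoidHom

open scoped Classical in
theorem projOn_apply (A : StronglyGradedRing Γ R S) (X : Set Γ) {g : Γ} {s : S}
    (hs : s ∈ A.component g) : A.projOn X s = if g ∈ X then s else 0 := by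
  have h : (AddEquiv.ofBijective (DirectSum.coeAddMonoidHom A.component)
      A.bijective_coeAddMonoidHom).symm s =
      DirectSum.of (fun g => A.component g) g ⟨s, hs⟩ := by
    rw [AddEquiv.symm_apply_eq]
    simp
  simp only [projOn, AddMonoidHom.comp_apply, AddEquiv.toAddMonoidHom_eq_coe,
    AddMonoidHom.coe_coe, h, DirectSum.toAddMonoid_of]
  split_ifs <;> rfl

theorem projOn_of_mem (A : StronglyGradedRing Γ R S) {X : Set Γ} {g : Γ} {s : S}
    (hs : s ∈ A.component g) (hg : g ∈ X) : A.projOn X s = s := by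
  rw [A.projOn_apply X hs, if_pos hg]

theorem projOn_of_notMem (A : StronglyGradedRing Γ R S) {X : Set Γ} {g : Γ} {s : S}
    (hs : s ∈ A.component g) (hg : g ∉ X) : A.projOn X s = 0 := by
  rw [A.projOn_apply X hs, if_neg hg]

theorem projOn_mem_restrict (A : StronglyGradedRing Γ R S) (K : Subgroup Γ) (s : S) :
    A.projOn K s ∈ A.restrict K := by
  induction s using A.homogeneous_induction with
  | hom g s hs =>
    by_cases hg : g ∈ K
    · rw [A.projOn_of_mem hs hg]
      exact A.component_le_restrict hg hs
    · rw [A.projOn_of_notMem hs hg]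
      exact zero_mem _
  | zero => simp
  | add s t hs ht => rw [map_add]; exact add_mem hs ht

theorem projOn_mul (A : StronglyGradedRing Γ R S) (K : Subgroup Γ) {b : S}
    (hb : b ∈ A.restrict K) (s : S) : A.projOn K (b * s) = b * A.projOn K s := by
  induction s using A.homogeneous_induction with
  | hom g s hs =>
    refine A.restrict_induction (p := fun b => A.projOn K (b * s) = b * A.projOn K s)
      (fun k hk b hb => ?_) (by simp) (fun b c hb hc => ?_) hb
    · by_cases hg : g ∈ K
      · rw [A.projOn_of_mem hs hg, A.projOn_of_mem (A.mul_mem_component hb hs) (K.mul_mem hk hg)]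
      · rw [A.projOn_of_notMem hs hg, A.projOn_of_notMem (A.mul_mem_component hb hs), mul_zero]
        exact fun h => hg ((K.mul_mem_cancel_left hk).1 h)
    · rw [add_mul, map_add, hb, hc, add_mul]
  | zero => simp
  | add s t hs ht => rw [mul_add, map_add, hs, ht, map_add, mul_add]

/-- The projection `R(Γ) → R(K)` along the components outside `K`, a map of left
`R(K)`-modules. -/
noncomputable def proj (A : StronglyGradedRing Γ R S) (K : Subgroup Γ) :
    S →ₗ[A.restrict K] A.restrict K where
  toFun s := ⟨A.projOn K s, A.projOn_mem_restrict K s⟩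
  map_add' s t := Subtype.ext (map_add _ s t)
  map_smul' b s := Subtype.ext (A.projOn_mul K b.2 s)

@[simp]
theorem coe_proj (A : StronglyGradedRing Γ R S) (K : Subgroup Γ) (s : S) :
    (A.proj K s : S) = A.projOn K s := rfl

/-- A partition of unity at `g`: finitely many `u_i ∈ S_g` and `v_i ∈ S_{g⁻¹}` with
`∑ u_i v_i = 1`. It plays the part of the unit `g` of a group ring. -/
structure UnityPartition (A : StronglyGradedRing Γ R S) (g : Γ) where
  /-- the index set -/
  index : Type
  [fintype : Fintype index]
  /-- the factors in `S_g` -/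
  left : index → S
  /-- the factors in `S_{g⁻¹}` -/
  right : index → S
  left_mem : ∀ i, left i ∈ A.component g
  right_mem : ∀ i, right i ∈ A.component g⁻¹
  sum_mul : ∑ i, left i * right i = 1

attribute [instance] UnityPartition.fintype

instance (A : StronglyGradedRing Γ R S) (g : Γ) : Nonempty (A.UnityPartition g) := by
  suffices H : ∀ s ∈ AddSubgroup.closure
      (Set.image2 (fun a b : S => a * b) (A.component g) (A.component g⁻¹)),
      ∃ (ι : Type) (_ : Fintype ι) (u v : ι → S), (∀ i, u i ∈ A.component g) ∧
        (∀ i, v i ∈ A.component g⁻¹) ∧ ∑ i, u i * v i = s by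
    obtain ⟨ι, _, u, v, hu, hv, h⟩ := H 1 (by
      rw [A.closure_mul_eq, mul_inv_cancel]
      exact A.one_mem_component)
    exact ⟨⟨ι, u, v, hu, hv, h⟩⟩
  intro s hs
  induction hs using AddSubgroup.closure_induction with
  | mem s hs =>
    obtain ⟨a, ha, b, hb, rfl⟩ := hs
    exact ⟨Unit, inferInstance, fun _ => a, fun _ => b, fun _ => ha, fun _ => hb, by simp⟩
  | zero => exact ⟨Empty, inferInstance, Empty.elim, Empty.elim, by simp, by simp, by simp⟩
  | add s t _ _ hs ht =>
    obtain ⟨ι, _, u, v, hu, hv, rfl⟩ := hs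
    obtain ⟨κ, _, u', v', hu', hv', rfl⟩ := ht
    exact ⟨ι ⊕ κ, inferInstance, Sum.elim u u', Sum.elim v v', by simp [hu, hu'],
      by simp [hv, hv'], by simp⟩
  | neg s _ hs =>
    obtain ⟨ι, _, u, v, hu, hv, rfl⟩ := hs
    exact ⟨ι, inferInstance, -u, v, fun i => neg_mem (hu i), hv, by simp⟩

/-- A chosen partition of unity at `g`. -/
noncomputable def unityPartition (A : StronglyGradedRing Γ R S) (g : Γ) : A.UnityPartition g :=
  Classical.arbitrary _

/-! ### Averaging over a subgroup of finite index -/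

/-- On `R(Γ)` itself the identity is the trace of the projection onto `R(K)`. -/
theorem sum_mul_projOn (A : StronglyGradedRing Γ R S) (K : Subgroup Γ) [Fintype (Γ ⧸ K)] (s : S) :
    ∑ c : Γ ⧸ K, ∑ i, (A.unityPartition c.out).left i *
      A.projOn K ((A.unityPartition c.out).right i * s) = s := by
  induction s using A.homogeneous_induction with
  | hom g s hs =>
    rw [Finset.sum_eq_single (g : Γ ⧸ K)]
    · have hg : ((g : Γ ⧸ K).out)⁻¹ * g ∈ K := by rw [← QuotientGroup.eq, QuotientGroup.out_eq']
      simp only [A.projOn_of_mem (X := K)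
        (A.mul_mem_component ((A.unityPartition (g : Γ ⧸ K).out).right_mem _) hs) hg,
        ← mul_assoc, ← Finset.sum_mul, UnityPartition.sum_mul, one_mul]
    · intro c _ hc
      refine Finset.sum_eq_zero fun i _ => ?_
      rw [A.projOn_of_notMem (X := K) (A.mul_mem_component
        ((A.unityPartition c.out).right_mem i) hs), mul_zero]
      intro h
      rw [SetLike.mem_coe, ← QuotientGroup.eq, QuotientGroup.out_eq'] at h
      exact hc h
    · simp
  | zero => simp
  | add s t hs ht => simp only [mul_add, map_add, Finset.sum_add_distrib, hs, ht]

section Averaging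

variable {X : Type*} [AddCommGroup X] [Module S X] {Y : Type*} [AddCommGroup Y] [Module S Y]

/-- The term `∑ u_i f(v_i x)` at the coset `gK`, multiplied by a homogeneous element `s` that moves
`gK` to `g'K`, is the term of the coset `g'K` at `s x`. With `s = 1` this says that the term
depends only on the coset. -/
theorem smul_sum_unityPartition (A : StronglyGradedRing Γ R S) {K : Subgroup Γ}
    (f : X →ₗ[A.restrict K] Y) {k g g' : Γ} (h : g'⁻¹ * (k * g) ∈ K)
    (P : A.UnityPartition g) (Q : A.UnityPartition g') {s : S} (hs : s ∈ A.component k) (x : X) :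
    s • ∑ i, P.left i • f (P.right i • x) = ∑ j, Q.left j • f (Q.right j • s • x) := by
  have hf : ∀ b ∈ A.restrict K, ∀ y, f (b • y) = b • f y := fun b hb y => f.map_smul ⟨b, hb⟩ y
  calc s • ∑ i, P.left i • f (P.right i • x)
      = ∑ i, (∑ j, Q.left j * Q.right j) • (s * P.left i) • f (P.right i • x) := by
        simp only [Q.sum_mul, one_smul, Finset.smul_sum, mul_smul]
    _ = ∑ i, ∑ j, Q.left j • (Q.right j * (s * P.left i)) • f (P.right i • x) := by
        simp only [Finset.sum_smul, mul_smul]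
    _ = ∑ i, ∑ j, Q.left j • f ((Q.right j * (s * P.left i)) • P.right i • x) := by
        refine Finset.sum_congr rfl fun i _ => Finset.sum_congr rfl fun j _ => ?_
        rw [hf _ (A.component_le_restrict h (A.mul_mem_component (Q.right_mem j)
          (A.mul_mem_component hs (P.left_mem i))))]
    _ = ∑ j, Q.left j • f (Q.right j • s • (∑ i, P.left i * P.right i) • x) := by
        rw [Finset.sum_comm]
        simp only [Finset.sum_smul, Finset.smul_sum, map_sum, mul_smul]
    _ = _ := by simp only [P.sum_mul, one_smul]

variable (A : StronglyGradedRing Γ R S) (K : Subgroup Γ) [K.FiniteIndex]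

/-- The trace `∑_{gK} g f g⁻¹` of an `R(K)`-linear map `f` between `R(Γ)`-modules, where `K` has
finite index in `Γ`; conjugation by `g` is done with a partition of unity at `g`. -/
noncomputable def trace (f : X →ₗ[A.restrict K] Y) : X →ₗ[S] Y :=
  letI := Fintype.ofFinite (Γ ⧸ K)
  { toFun := fun x => ∑ c : Γ ⧸ K, ∑ i, (A.unityPartition c.out).left i •
      f ((A.unityPartition c.out).right i • x)
    map_add' := fun x y => by simp only [smul_add, map_add, Finset.sum_add_distrib]
    map_smul' := fun s x => by
      rw [RingHom.id_apply]
      induction s using A.homogeneous_induction with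
      | hom k s hs =>
        rw [Finset.smul_sum]
        refine (Equiv.sum_comp (MulAction.toPerm k : Γ ⧸ K ≃ Γ ⧸ K) _).symm.trans
          (Finset.sum_congr rfl fun c _ => (A.smul_sum_unityPartition f ?_ _ _ hs x).symm)
        rw [← QuotientGroup.eq, QuotientGroup.out_eq', MulAction.toPerm_apply, ← smul_eq_mul,
          ← MulAction.Quotient.smul_coe, QuotientGroup.out_eq']
      | zero => simp
      | add s t hs ht =>
        simp only [add_smul, smul_add, map_add, Finset.sum_add_distrib] at hs ht ⊢
        rw [hs, ht] }

theorem trace_apply [fin : Fintype (Γ ⧸ K)] (f : X →ₗ[A.restrict K] Y) (x : X) :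
    A.trace K f x = ∑ c : Γ ⧸ K, ∑ i, (A.unityPartition c.out).left i •
      f ((A.unityPartition c.out).right i • x) := by
  obtain rfl := Subsingleton.elim fin (Fintype.ofFinite (Γ ⧸ K))
  rfl

theorem trace_apply_map {Z : Type*} [AddCommGroup Z] [Module S Z] (f : X →ₗ[A.restrict K] Y)
    (g : Z →ₗ[S] X) (z : Z) (h : Z →ₗ[A.restrict K] Y) (hfg : ∀ z, f (g z) = h z) :
    A.trace K f (g z) = A.trace K h z := by
  have := Fintype.ofFinite (Γ ⧸ K)
  simp only [trace_apply, ← map_smul, hfg]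

theorem map_trace_apply {Z : Type*} [AddCommGroup Z] [Module S Z] (f : X →ₗ[A.restrict K] Y)
    (g : Y →ₗ[S] Z) (x : X) (h : X →ₗ[A.restrict K] Z) (hgf : ∀ x, g (f x) = h x) :
    g (A.trace K f x) = A.trace K h x := by
  have := Fintype.ofFinite (Γ ⧸ K)
  simp only [trace_apply, map_sum, map_smul, hgf]

/-- A projective `R(Γ)`-module is relatively `K`-projective: its identity is a trace (Higman's
criterion). -/
theorem exists_trace_eq_id (N : Type*) [AddCommGroup N] [Module S N] [Module.Projective S N] :
    ∃ α : N →ₗ[A.restrict K] N, ∀ x, A.trace K α x = x := by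
  have := Fintype.ofFinite (Γ ⧸ K)
  obtain ⟨σ, hσ⟩ := Module.Projective.out (R := S) (P := N)
  let π : S →ₗ[A.restrict K] S :=
    { toFun := A.projOn K
      map_add' := map_add _
      map_smul' := fun b s => A.projOn_mul K b.2 s }
  let β : (N →₀ S) →ₗ[A.restrict K] (N →₀ S) := Finsupp.mapRange.linearMap π
  have hβ : ∀ y, A.trace K β y = y := by
    intro y
    rw [trace_apply]
    ext n
    simpa [Finsupp.finsetSum_apply, β, π] using A.sum_mul_projOn K (y n)
  let σ' : N →ₗ[A.restrict K] (N →₀ S) :=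
    σ.restrictScalars _
  let τ : (N →₀ S) →ₗ[A.restrict K] N := (Finsupp.linearCombination S id).restrictScalars _
  refine ⟨τ ∘ₗ β ∘ₗ σ', fun x => ?_⟩
  rw [← A.map_trace_apply K (β ∘ₗ σ') (Finsupp.linearCombination S id) x _ fun _ => rfl,
    ← A.trace_apply_map K β σ x _ fun _ => rfl, hβ, hσ]

/-- If `K` has finite index in `Γ`, an `R(Γ)`-module which is projective over `R(K)` and has
projective dimension at most one over `R(Γ)` is projective over `R(Γ)`. -/
theorem projective_of_projective_ker {F M : Type*} [AddCommGroup F] [Module S F] [AddCommGroup M]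
    [Module S M] [Module.Projective S F] (q : F →ₗ[S] M) (hq : Function.Surjective q)
    [Module.Projective S (LinearMap.ker q)] [Module.Projective (A.restrict K) M] :
    Module.Projective S M := by
  obtain ⟨α, hα⟩ := A.exists_trace_eq_id K (LinearMap.ker q)
  let q' : F →ₗ[A.restrict K] M := q.restrictScalars _
  obtain ⟨σ, hσ⟩ := Module.projective_lifting_property q' LinearMap.id hq
  have hσ' : ∀ m, q (σ m) = m := LinearMap.congr_fun hσ
  -- the `R(K)`-linear retraction of `F` onto the kernel defined by `σ`
  let r : F →ₗ[A.restrict K] LinearMap.ker q :=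
    { toFun := fun x => ⟨x - σ (q x), by simp [hσ']⟩
      map_add' := fun x y => Subtype.ext (by simp only [map_add, Submodule.coe_add]; abel)
      map_smul' := fun b x => Subtype.ext (by
        have h1 : q (b • x) = b • q x := q'.map_smul b x
        simp only [h1, map_smul, RingHom.id_apply, ← smul_sub]
        rfl) }
  have hr : ∀ n : LinearMap.ker q, r n = n := fun n => Subtype.ext (by
    change (n : F) - σ (q n) = n
    rw [LinearMap.mem_ker.1 n.2, map_zero, sub_zero])
  let ρ : F →ₗ[S] LinearMap.ker q := A.trace K (α ∘ₗ r)
  have hρ : ∀ n : LinearMap.ker q, ρ n = n := fun n =>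
    (A.trace_apply_map K (α ∘ₗ r) (LinearMap.ker q).subtype n α fun n => by
      simp [hr]).trans (hα n)
  let s : F ⧸ LinearMap.ker q →ₗ[S] F :=
    (LinearMap.ker q).liftQ (LinearMap.id - (LinearMap.ker q).subtype ∘ₗ ρ) fun n hn => by
      simp [hρ ⟨n, hn⟩]
  refine Module.Projective.of_split (s ∘ₗ (q.quotKerEquivOfSurjective hq).symm.toLinearMap) q ?_
  ext m
  obtain ⟨x, rfl⟩ := hq m
  have hx : (q.quotKerEquivOfSurjective hq).symm (q x) = Submodule.Quotient.mk x := by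
    rw [LinearEquiv.symm_apply_eq]
    rfl
  simp [hx, s]

end Averaging

/-! ### Restriction of projective modules to a subgroup -/

/-- `R(Γ)` is a projective left `R(K)`-module: it is the sum of the modules `⨁_{k ∈ K} S_{kg⁻¹}`,
and partitions of unity at `g` provide finite dual bases of these. -/
theorem projective_restrict_self (A : StronglyGradedRing Γ R S) (K : Subgroup Γ) :
    Module.Projective (A.restrict K) S := by
  classical
  let J := Σ c : Γ ⧸ K, (A.unityPartition c.out).index
  let l : J → S := fun j => (A.unityPartition j.1.out).left j.2
  let r : J → S := fun j => (A.unityPartition j.1.out).right j.2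
  have key : ∀ g, ∀ s ∈ A.component g, ∀ j : J, j.1 ≠ (g⁻¹ : Γ) →
      A.projOn K (s * l j) = 0 := by
    intro g s hs j hj
    refine A.projOn_of_notMem (A.mul_mem_component hs
      ((A.unityPartition j.1.out).left_mem j.2)) fun h => hj ?_
    have h' : ((g⁻¹ : Γ) : Γ ⧸ K) = j.1.out := by
      rw [QuotientGroup.eq, inv_inv]
      exact h
    rw [h', QuotientGroup.out_eq']
  have fin : ∀ s, (Function.support fun j => A.proj K (s * l j)).Finite := by
    intro s
    induction s using A.homogeneous_induction with
    | hom g s hs =>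
      refine (Set.finite_range fun i => (⟨(g⁻¹ : Γ), i⟩ : J)).subset fun j hj => ?_
      obtain ⟨c, i⟩ := j
      by_cases hc : c = (g⁻¹ : Γ)
      · subst hc
        exact ⟨i, rfl⟩
      · exact absurd (Subtype.ext (key g s hs ⟨c, i⟩ hc)) hj
    | zero => simp [Function.support]
    | add s t hs ht =>
      refine (hs.union ht).subset fun j hj => ?_
      by_contra h
      simp only [Set.mem_union, Function.mem_support, not_or, not_not] at h
      exact hj (by simp only [add_mul, map_add, h.1, h.2, add_zero])
  let φ : S →ₗ[A.restrict K] (J →₀ A.restrict K) :=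
    { toFun := fun s => Finsupp.ofSupportFinite _ (fin s)
      map_add' := fun s t => Finsupp.ext fun j =>
        (congrArg (A.proj K) (add_mul s t (l j))).trans (map_add _ _ _)
      map_smul' := fun b s => Finsupp.ext fun j =>
        (congrArg (A.proj K) (smul_mul_assoc b s (l j))).trans (map_smul _ _ _) }
  have hφ : ∀ s j, φ s j = A.proj K (s * l j) := fun _ _ => rfl
  refine Module.Projective.of_split φ (Finsupp.linearCombination (A.restrict K) r) ?_
  ext s
  rw [LinearMap.comp_apply, LinearMap.id_apply]
  induction s using A.homogeneous_induction with
  | hom g s hs =>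
    let c : Γ ⧸ K := (g⁻¹ : Γ)
    rw [Finsupp.linearCombination_apply, Finsupp.sum_of_support_subset
      (s := Finset.univ.map (Function.Embedding.sigmaMk c)) _ _ _ (by simp), Finset.sum_map]
    · have hg : g * c.out ∈ K := by
        have : ((g⁻¹ : Γ) : Γ ⧸ K) = c.out := by rw [QuotientGroup.out_eq']
        rwa [QuotientGroup.eq, inv_inv] at this
      have h : ∀ i, φ s ⟨c, i⟩ • r ⟨c, i⟩ = s * (l ⟨c, i⟩ * r ⟨c, i⟩) := fun i => by
        rw [Subring.smul_def, hφ, coe_proj, A.projOn_of_mem (A.mul_mem_component hs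
          ((A.unityPartition c.out).left_mem i)) hg, smul_eq_mul, mul_assoc]
      exact (Finset.sum_congr rfl fun i _ => h i).trans (by
        rw [← Finset.mul_sum]
        exact (congrArg _ (A.unityPartition c.out).sum_mul).trans (mul_one s))
    · intro j hj
      obtain ⟨d, i⟩ := j
      rw [Finsupp.mem_support_iff] at hj
      by_cases hd : d = c
      · subst hd
        exact Finset.mem_map.2 ⟨i, Finset.mem_univ _, rfl⟩
      · exact absurd (Subtype.ext (key g s hs ⟨d, i⟩ hd)) hj
  | zero => simp
  | add s t hs ht => rw [map_add, map_add, hs, ht]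

theorem projective_restrict (A : StronglyGradedRing Γ R S) (K : Subgroup Γ) (M : Type*)
    [AddCommGroup M] [Module S M] [Module.Projective S M] :
    Module.Projective (A.restrict K) M := by
  classical
  have := A.projective_restrict_self K
  have : Module.Projective (A.restrict K) (M →₀ S) :=
    .of_equiv' (finsuppLequivDFinsupp (A.restrict K)).symm
  obtain ⟨σ, hσ⟩ := Module.Projective.out (R := S) (P := M)
  exact .of_split (σ.restrictScalars _) ((Finsupp.linearCombination S id).restrictScalars _)
    (LinearMap.ext hσ)

/-! ### The strongly graded ring of a subgroup -/

/-- The subring `R(L)`, as a ring strongly graded by the subgroup `L`. -/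
def restrictGraded (A : StronglyGradedRing Γ R S) (L : Subgroup Γ) :
    StronglyGradedRing L R (A.restrict L) where
  component g := (A.component g).comap (A.restrict L).subtype.toAddMonoidHom
  isInternal := by
    classical
    set C : L → AddSubgroup (A.restrict L) := fun g =>
      (A.component g).comap (A.restrict L).subtype.toAddMonoidHom
    suffices Function.Bijective (DirectSum.coeAddMonoidHom C) by
      unfold DirectSum.IsInternal
      convert this
    constructor
    · rw [injective_iff_map_eq_zero]
      intro x hx
      have h : ∀ g : L, ∀ y, A.projOn {(g : Γ)} (DirectSum.coeAddMonoidHom C y : A.restrict L) =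
          (y g : A.restrict L) := by
        intro g y
        induction y using DirectSum.induction_on with
        | zero => simp
        | of i y =>
          rw [DirectSum.coeAddMonoidHom_of]
          have hy : ((y : A.restrict L) : S) ∈ A.component i := y.2
          by_cases hi : i = g
          · subst hi
            rw [A.projOn_of_mem hy (Set.mem_singleton _), DirectSum.of_eq_same]
          · rw [A.projOn_of_notMem hy fun h => hi (Subtype.ext h),
              DirectSum.of_eq_of_ne _ _ _ (Ne.symm hi)]
            rfl
        | add y z hy hz => simp [hy, hz]
      ext g
      rw [← h g x, hx]
      simp
    · rintro ⟨s, hs⟩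
      suffices H : ∃ y, (DirectSum.coeAddMonoidHom C y : S) = s from
        H.imp fun y hy => Subtype.ext hy
      refine A.restrict_induction (p := fun s => ∃ y, (DirectSum.coeAddMonoidHom C y : S) = s)
        (fun g hg s hs => ?_) ⟨0, by simp⟩ ?_ hs
      · exact ⟨DirectSum.of (fun g => C g) ⟨g, hg⟩ ⟨⟨s, A.component_le_restrict hg hs⟩, hs⟩, by
          rw [DirectSum.coeAddMonoidHom_of]⟩
      · rintro _ _ ⟨y, rfl⟩ ⟨z, rfl⟩
        exact ⟨y + z, by simp⟩
  closure_mul_eq g h := by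
    apply AddSubgroup.map_injective (f := (A.restrict L).subtype.toAddMonoidHom)
      Subtype.val_injective
    have hC : ∀ g : L, (Subtype.val : A.restrict L → S) ''
        ((A.component g).comap (A.restrict L).subtype.toAddMonoidHom) = A.component g := fun g =>
      Set.ext fun s => ⟨by rintro ⟨x, hx, rfl⟩; exact hx,
        fun hs => ⟨⟨s, A.component_le_restrict g.2 hs⟩, hs, rfl⟩⟩
    apply SetLike.coe_injective
    rw [AddMonoidHom.map_closure]
    refine Eq.trans ?_ (hC (g * h)).symm
    rw [Subgroup.coe_mul, ← A.closure_mul_eq, ← hC g, ← hC h]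
    congr 2
    exact Set.image_image2_distrib fun _ _ => rfl
  coeff := A.coeff.codRestrict (A.restrict L) fun x =>
    A.component_le_restrict L.one_mem (by
      rw [← SetLike.mem_coe, ← A.range_coeff]
      exact ⟨x, rfl⟩)
  coeff_injective x y h := A.coeff_injective (congrArg Subtype.val h)
  range_coeff := by
    ext s
    have h : (s : S) ∈ (A.coeff.range : Set S) ↔ (s : S) ∈ A.component 1 := by
      rw [A.range_coeff, SetLike.mem_coe]
    exact (exists_congr fun x => Subtype.ext_iff).trans h

/-- For `K ≤ L` the subring `R(K)` is the same in `R(L)` and in `R(Γ)`. -/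
theorem mem_restrictGraded_restrict (A : StronglyGradedRing Γ R S) {K L : Subgroup Γ} (h : K ≤ L)
    {x : A.restrict L} :
    x ∈ (A.restrictGraded L).restrict (K.subgroupOf L) ↔ (x : S) ∈ A.restrict K := by
  constructor
  · intro hx
    exact (A.restrictGraded L).restrict_induction (p := fun x => (x : S) ∈ A.restrict K)
      (fun g hg s hs => A.component_le_restrict (Subgroup.mem_subgroupOf.1 hg) hs)
      (zero_mem _) (fun _ _ => add_mem) hx
  · intro hx
    suffices ∃ y ∈ (A.restrictGraded L).restrict (K.subgroupOf L), (y : S) = x by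
      obtain ⟨y, hy, hyx⟩ := this
      rwa [← Subtype.ext hyx]
    refine A.restrict_induction
      (p := fun s => ∃ y ∈ (A.restrictGraded L).restrict (K.subgroupOf L), (y : S) = s)
      (fun g hg s hs => ?_) ⟨0, zero_mem _, rfl⟩ ?_ hx
    · exact ⟨⟨s, A.component_le_restrict (h hg) hs⟩, (A.restrictGraded L).component_le_restrict
        (g := ⟨g, h hg⟩) (Subgroup.mem_subgroupOf.2 hg) hs, rfl⟩
    · rintro _ _ ⟨y, hy, rfl⟩ ⟨z, hz, rfl⟩
      exact ⟨y + z, add_mem hy hz, rfl⟩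

theorem projective_restrictGraded_iff (A : StronglyGradedRing Γ R S) {K L : Subgroup Γ} (h : K ≤ L)
    (M : Type*) [AddCommGroup M] [Module S M] :
    Module.Projective ((A.restrictGraded L).restrict (K.subgroupOf L)) M ↔
      Module.Projective (A.restrict K) M := by
  let e : (A.restrictGraded L).restrict (K.subgroupOf L) ≃+* A.restrict K :=
    { toFun := fun x => ⟨x.1, (A.mem_restrictGraded_restrict h).1 x.2⟩
      invFun := fun x => ⟨⟨x.1, A.restrict_mono h x.2⟩, (A.mem_restrictGraded_restrict h).2 x.2⟩
      left_inv := fun _ => rfl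
      right_inv := fun _ => rfl
      map_mul' := fun _ _ => rfl
      map_add' := fun _ _ => rfl }
  have := RingHomInvPair.of_ringEquiv e
  have := RingHomInvPair.of_ringEquiv e.symm
  let f : M ≃ₛₗ[(e : (A.restrictGraded L).restrict (K.subgroupOf L) →+* A.restrict K)] M :=
    { AddEquiv.refl M with map_smul' := fun _ _ => rfl }
  exact ⟨fun _ => .of_equiv f, fun _ => .of_equiv f.symm⟩

theorem projective_of_projective_restrict_top (A : StronglyGradedRing Γ R S) (M : Type*)
    [AddCommGroup M] [Module S M] [Module.Projective (A.restrict ⊤) M] :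
    Module.Projective S M := by
  have htop : ∀ s, s ∈ A.restrict ⊤ := fun s => A.restrict_top ▸ Subring.mem_top s
  let e : A.restrict ⊤ ≃+* S :=
    { (A.restrict ⊤).subtype with
      invFun := fun s => ⟨s, htop s⟩
      left_inv := fun _ => rfl
      right_inv := fun _ => rfl }
  have := RingHomInvPair.of_ringEquiv e
  have := RingHomInvPair.of_ringEquiv e.symm
  let f : M ≃ₛₗ[(e : A.restrict ⊤ →+* S)] M :=
    { AddEquiv.refl M with map_smul' := fun _ _ => rfl }
  exact .of_equiv f

/-- Projectivity over `R(L)` passes to `R(K)` for subgroups `K ≤ L`. -/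
theorem projective_restrict_of_le (A : StronglyGradedRing Γ R S) {K L : Subgroup Γ} (h : K ≤ L)
    (M : Type*) [AddCommGroup M] [Module S M] [Module.Projective (A.restrict L) M] :
    Module.Projective (A.restrict K) M :=
  (A.projective_restrictGraded_iff h M).1 ((A.restrictGraded L).projective_restrict _ M)

end StronglyGradedRing

/-! ### Unions of well-ordered chains of direct summands -/

section Chain

variable {S : Type*} [Ring S] {F : Type*} [AddCommGroup F] [Module S F]

/-- Auslander's argument: if `(N i)` is a well-ordered chain of submodules of a projective module
such that every `N i` and every `⨆ j < i, N j` is a direct summand, then `⨆ i, N i` is the direct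
sum of complements of `⨆ j < i, N j` in `N i`, hence is projective. -/
theorem Submodule.projective_iSup_of_isProj {ι : Type*} [LinearOrder ι] [WellFoundedLT ι]
    [Module.Projective S F] (N : ι → Submodule S F)
    (hN : ∀ i, ∃ p : F →ₗ[S] F, LinearMap.IsProj (N i) p) (mono : Monotone N)
    (hlt : ∀ i : ι, ∃ p : F →ₗ[S] F, LinearMap.IsProj (⨆ j : Set.Iio i, N j) p) :
    Module.Projective S (⨆ i, N i : Submodule S F) := by
  classical
  choose p hp using hN
  choose q hq using hlt
  have hle : ∀ i, ⨆ j : Set.Iio i, N j ≤ N i := fun i => iSup_le fun j => mono j.2.le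
  let C : ι → Submodule S F := fun i => N i ⊓ LinearMap.ker (q i)
  have mem_C : ∀ i x, x ∈ N i → x - q i x ∈ C i := fun i x hx =>
    ⟨sub_mem hx (hle i ((hq i).map_mem x)), by
      rw [SetLike.mem_coe, LinearMap.mem_ker, map_sub, (hq i).map_id _ ((hq i).map_mem x),
        sub_self]⟩
  have proj_C : ∀ i, Module.Projective S (C i) := fun i => by
    refine .of_split (C i).subtype
      ((p i - q i ∘ₗ p i).codRestrict (C i) fun x => mem_C i _ ((hp i).map_mem x)) ?_
    ext x
    have hx : q i x = 0 := x.2.2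
    simp [(hp i).map_id _ x.2.1, hx]
  have sup_C : ⨆ i, N i = ⨆ i, C i := by
    refine le_antisymm (iSup_le fun i => ?_) (iSup_mono fun i => inf_le_left)
    induction i using WellFoundedLT.induction with
    | ind i ih =>
      intro x hx
      rw [← sub_add_cancel x (q i x)]
      exact add_mem (Submodule.mem_iSup_of_mem i (mem_C i x hx))
        (iSup_le (fun j : Set.Iio i => ih j j.2) ((hq i).map_mem x))
  have inj : Function.Injective (DFinsupp.lsum ℕ fun i => (C i).subtype) := by
    rw [injective_iff_map_eq_zero]
    intro x hx
    by_contra hx0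
    have hne : x.support.Nonempty := by
      rwa [Finset.nonempty_iff_ne_empty, Ne, DFinsupp.support_eq_empty]
    -- the component of largest index lies in the sum of the others and in a complement of it
    let i := x.support.max' hne
    have hi : i ∈ x.support := x.support.max'_mem hne
    have hsum : (x i : F) + ∑ j ∈ x.support.erase i, (x j : F) = 0 := by
      rw [Finset.add_sum_erase _ (fun j => (x j : F)) hi, ← hx]
      simp [DFinsupp.sumAddHom_apply, DFinsupp.sum]
    have hmem : (x i : F) ∈ ⨆ j : Set.Iio i, N j := by
      rw [eq_neg_of_add_eq_zero_left hsum]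
      refine neg_mem (sum_mem fun j hj => ?_)
      have hji : j < i := x.support.lt_max'_of_mem_erase_max' hne hj
      exact Submodule.mem_iSup_of_mem (⟨j, hji⟩ : Set.Iio i) (x j).2.1
    refine DFinsupp.mem_support_iff.1 hi (Subtype.ext ?_)
    rw [← (hq i).map_id _ hmem]
    exact (x i).2.2
  rw [sup_C, Submodule.iSup_eq_range_dfinsupp_lsum]
  exact .of_equiv' (LinearEquiv.ofInjective _ inj)

end Chain

/-! ### A presentation of induced modules -/

section Relations

variable {S : Type*} [Ring S] (M : Type*) [AddCommGroup M] [Module S M]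

/-- The kernel of the map from the free `S`-module on the set `M` to `S ⊗_T M`: the submodule
generated by the relations that make `m ↦ [m]` a `T`-linear map. The quotient serves as the induced
module `S ⊗_T M` over a noncommutative ring. -/
noncomputable def inducedRelations (T : Subring S) : Submodule S (M →₀ S) :=
  Submodule.span S
    ({x | ∃ m n : M, x = Finsupp.single (m + n) 1 - Finsupp.single m 1 - Finsupp.single n 1} ∪
      {x | ∃ b ∈ T, ∃ m : M, x = Finsupp.single (b • m) 1 - Finsupp.single m b})

variable {M}

theorem single_add_sub_mem_inducedRelations (T : Subring S) (m n : M) :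
    Finsupp.single (m + n) 1 - Finsupp.single m 1 - Finsupp.single n 1 ∈ inducedRelations M T :=
  Submodule.subset_span (Or.inl ⟨m, n, rfl⟩)

theorem single_smul_sub_mem_inducedRelations {T : Subring S} {b : S} (hb : b ∈ T) (m : M) :
    Finsupp.single (b • m) 1 - Finsupp.single m b ∈ inducedRelations M T :=
  Submodule.subset_span (Or.inr ⟨b, hb, m, rfl⟩)

theorem inducedRelations_le {T : Subring S} {N : Submodule S (M →₀ S)}
    (hadd : ∀ m n : M,
      Finsupp.single (m + n) 1 - Finsupp.single m 1 - Finsupp.single n 1 ∈ N)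
    (hsmul : ∀ b ∈ T, ∀ m : M, Finsupp.single (b • m) 1 - Finsupp.single m b ∈ N) :
    inducedRelations M T ≤ N :=
  Submodule.span_le.2 (by
    rintro _ (⟨m, n, rfl⟩ | ⟨b, hb, m, rfl⟩)
    exacts [hadd m n, hsmul b hb m])

theorem inducedRelations_mono {T U : Subring S} (h : T ≤ U) :
    inducedRelations M T ≤ inducedRelations M U :=
  inducedRelations_le (single_add_sub_mem_inducedRelations U) fun _ hb =>
    single_smul_sub_mem_inducedRelations (h hb)

/-- `S ⊗_S M` is `M`. -/
theorem inducedRelations_top :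
    inducedRelations M (⊤ : Subring S) =
      LinearMap.ker (Finsupp.linearCombination S (id : M → M)) := by
  refine le_antisymm (inducedRelations_le (fun m n => by simp) fun b _ m => by simp) fun x hx => ?_
  have h : ∀ x : M →₀ S, Finsupp.single (Finsupp.linearCombination S id x) 1 - x ∈
      inducedRelations M (⊤ : Subring S) := by
    intro x
    induction x using Finsupp.induction_linear with
    | zero => simpa using single_smul_sub_mem_inducedRelations (Subring.mem_top (0 : S)) (0 : M)
    | add x y hx hy =>
      have := add_mem (add_mem (single_add_sub_mem_inducedRelations ⊤
        (Finsupp.linearCombination S id x) (Finsupp.linearCombination S id y)) hx) hy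
      rw [map_add]
      convert this using 1
      abel
    | single m s => simpa using single_smul_sub_mem_inducedRelations (Subring.mem_top s) m
  have h0 : Finsupp.single (0 : M) (1 : S) ∈ inducedRelations M (⊤ : Subring S) := by
    simpa using h 0
  have hx' := h x
  rw [LinearMap.mem_ker.1 hx] at hx'
  simpa using sub_mem h0 hx'

/-- If `M` is projective over `T`, then `S ⊗_T M` is projective over `S`, so that the relations
form a direct summand of the free module. -/
theorem exists_isProj_inducedRelations (T : Subring S) [Module.Projective T M] :
    ∃ p : (M →₀ S) →ₗ[S] (M →₀ S), LinearMap.IsProj (inducedRelations M T) p := by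
  let π := (inducedRelations M T).mkQ
  let j : M →ₗ[T] (M →₀ S) ⧸ inducedRelations M T :=
    { toFun := fun m => π (Finsupp.single m 1)
      map_add' := fun m n => by
        rw [← map_add, ← sub_eq_zero, ← map_sub, ← sub_sub]
        exact (Submodule.Quotient.mk_eq_zero _).2 (single_add_sub_mem_inducedRelations T m n)
      map_smul' := fun b m => by
        have hb : (b : S) • Finsupp.single m (1 : S) = Finsupp.single m (b : S) := by simp
        change π (Finsupp.single ((b : S) • m) 1) = (b : S) • π (Finsupp.single m 1)
        rw [← map_smul, hb, ← sub_eq_zero, ← map_sub]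
        exact (Submodule.Quotient.mk_eq_zero _).2 (single_smul_sub_mem_inducedRelations b.2 m) }
  obtain ⟨σ, hσ⟩ := Module.projective_lifting_property (π.restrictScalars T) j
    (inducedRelations M T).mkQ_surjective
  -- the `S`-linear extension of `σ` factors over the quotient and splits `π`
  let E : (M →₀ S) →ₗ[S] (M →₀ S) := Finsupp.linearCombination S σ
  have hE : inducedRelations M T ≤ LinearMap.ker E := by
    refine inducedRelations_le (fun m n => by simp [E]) fun b hb m => ?_
    have : σ (b • m) = b • σ m := σ.map_smul ⟨b, hb⟩ m
    simp [E, this]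
  have hπ : π ∘ₗ E = π := by
    ext m
    simpa [E] using! LinearMap.congr_fun hσ m
  refine ⟨LinearMap.id - E, fun x => ?_, fun x hx => ?_⟩
  · rw [← Submodule.Quotient.mk_eq_zero, LinearMap.sub_apply, LinearMap.id_apply]
    change π (x - E x) = 0
    rw [map_sub, ← LinearMap.comp_apply, hπ, sub_self]
  · rw [LinearMap.sub_apply, LinearMap.mem_ker.1 (hE hx), sub_zero, LinearMap.id_apply]

end Relations

/-! ### Transfinite induction over the subgroups -/

namespace StronglyGradedRing

open Cardinal

section

variable {Γ : Type*} [Group Γ] {R : Type*} [Ring R] {S : Type*} [Ring S]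

theorem mem_restrict_iSup (A : StronglyGradedRing Γ R S) {ι : Type*} [LinearOrder ι] [Nonempty ι]
    {L : ι → Subgroup Γ} (mono : Monotone L) {s : S} (hs : s ∈ A.restrict (⨆ i, L i)) :
    ∃ i, s ∈ A.restrict (L i) := by
  refine A.restrict_induction (p := fun s => ∃ i, s ∈ A.restrict (L i)) (fun g hg s hs => ?_)
    ⟨Classical.arbitrary ι, zero_mem _⟩ ?_ hs
  · obtain ⟨i, hi⟩ := (Subgroup.mem_iSup_of_directed mono.directed_le).1 hg
    exact ⟨i, A.component_le_restrict hi hs⟩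
  · rintro s t ⟨i, hi⟩ ⟨j, hj⟩
    exact ⟨max i j, add_mem (A.restrict_mono (mono (le_max_left i j)) hi)
      (A.restrict_mono (mono (le_max_right i j)) hj)⟩

theorem inducedRelations_restrict_iSup (A : StronglyGradedRing Γ R S) {ι : Type*} [LinearOrder ι]
    [Nonempty ι] {L : ι → Subgroup Γ} (mono : Monotone L) (M : Type*) [AddCommGroup M]
    [Module S M] :
    inducedRelations M (A.restrict (⨆ i, L i)) = ⨆ i, inducedRelations M (A.restrict (L i)) := by
  refine le_antisymm (inducedRelations_le (fun m n => ?_) fun b hb m => ?_)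
    (iSup_le fun i => inducedRelations_mono (A.restrict_mono (le_iSup L i)))
  · exact Submodule.mem_iSup_of_mem (Classical.arbitrary ι)
      (single_add_sub_mem_inducedRelations _ m n)
  · obtain ⟨i, hi⟩ := A.mem_restrict_iSup mono hb
    exact Submodule.mem_iSup_of_mem i (single_smul_sub_mem_inducedRelations hi m)

/-- Let `Γ` be the union of a well-ordered chain of subgroups `L i`, and let `M` be projective over
all `R(L i)` and `R(⋃ j < i, L j)`. Then `M` has projective dimension at most one over `R(Γ)`; if it
is also projective over `R(K)` for some `K` of finite index, it is projective. -/
theorem projective_of_chain (A : StronglyGradedRing Γ R S) (K : Subgroup Γ) [K.FiniteIndex]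
    (M : Type*) [AddCommGroup M] [Module S M] [Module.Projective (A.restrict K) M]
    {ι : Type*} [LinearOrder ι] [WellFoundedLT ι] [Nonempty ι] {L : ι → Subgroup Γ}
    (mono : Monotone L) (htop : ⨆ i, L i = ⊤)
    (hL : ∀ i, Module.Projective (A.restrict (L i)) M)
    (hlt : ∀ i : ι, Module.Projective (A.restrict (⨆ j : Set.Iio i, L j)) M) :
    Module.Projective S M := by
  have hker : LinearMap.ker (Finsupp.linearCombination S (id : M → M)) =
      ⨆ i, inducedRelations M (A.restrict (L i)) := by
    rw [← A.inducedRelations_restrict_iSup mono, htop, A.restrict_top, inducedRelations_top]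
  have : Module.Projective S (LinearMap.ker (Finsupp.linearCombination S (id : M → M))) := by
    rw [hker]
    refine Submodule.projective_iSup_of_isProj _ (fun i => exists_isProj_inducedRelations _)
      (fun i j h => inducedRelations_mono (A.restrict_mono (mono h))) fun i => ?_
    rcases isEmpty_or_nonempty (Set.Iio i) with h | h
    -- at the least index the sum is `0`, not the relations of the trivial subgroup
    · exact ⟨0, fun x => zero_mem _, fun x hx => by
        rw [iSup_of_empty, Submodule.mem_bot] at hx
        simp [hx]⟩
    · rw [← A.inducedRelations_restrict_iSup (L := fun j : Set.Iio i => L j)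
        fun j k h => mono h]
      exact exists_isProj_inducedRelations _
  exact A.projective_of_projective_ker K (Finsupp.linearCombination S id)
    (Finsupp.linearCombination_surjective S Function.surjective_id)

/-- If `M` is projective over `R(K)` for a subgroup `K` of finite index and over `R(L)` for all
finitely generated `L`, then by induction on the cardinality of a generating set it is projective
over `R(L)` for all subgroups `L`. -/
theorem projective_restrict_closure (A : StronglyGradedRing Γ R S) (K : Subgroup Γ) [K.FiniteIndex]
    (M : Type*) [AddCommGroup M] [Module S M] [Module.Projective (A.restrict K) M]
    (hfg : ∀ L : Subgroup Γ, L.FG → Module.Projective (A.restrict L) M) (X : Set Γ) :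
    Module.Projective (A.restrict (Subgroup.closure X)) M := by
  induction hc : #X using WellFoundedLT.induction generalizing X with
  | ind c ih =>
    subst hc
    rcases X.finite_or_infinite with hX | hX
    · exact hfg _ ((Subgroup.fg_iff _).2 ⟨X, rfl, hX⟩)
    have := hX.to_subtype
    obtain ⟨_, _, hord⟩ := exists_ord_eq_type_lt X
    let Γ' := Subgroup.closure X
    let A' := A.restrictGraded Γ'
    let x : X → Γ' := fun i => ⟨i, Subgroup.subset_closure i.2⟩
    have small : ∀ s : Set X, #s < #X →
        Module.Projective (A'.restrict (Subgroup.closure (x '' s))) M := by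
      intro s hs
      have h := ih _ (mk_image_le.trans_lt hs) (Subtype.val '' s) rfl
      have hmap : (Subgroup.closure (x '' s)).map Γ'.subtype =
          Subgroup.closure (Subtype.val '' s) := by
        rw [MonoidHom.map_closure, Set.image_image]
        rfl
      have hcomap : (Subgroup.closure (Subtype.val '' s)).subgroupOf Γ' =
          Subgroup.closure (x '' s) := by
        rw [← hmap]
        exact Subgroup.comap_map_eq_self_of_injective Γ'.subtype_injective _
      rw [← hcomap]
      exact (A.projective_restrictGraded_iff
        (Subgroup.closure_mono (Subtype.coe_image_subset X s)) M).2 h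
    have hIio : ∀ i : X, #(Set.Iio i) < #X := fun i => mk_Iio_lt i hord
    have hIic : ∀ i : X, #(Set.Iic i) < #X := fun i => by
      rw [← Set.Iio_insert]
      exact mk_insert_le.trans_lt (add_lt_of_lt (aleph0_le_mk X) (hIio i)
        (one_lt_aleph0.trans_le (aleph0_le_mk X)))
    have : Module.Projective (A'.restrict (K.subgroupOf Γ')) M := by
      have := A.projective_restrict_of_le (inf_le_left : K ⊓ Γ' ≤ K) M
      rw [← Subgroup.inf_subgroupOf_right]
      exact (A.projective_restrictGraded_iff inf_le_right M).2 this
    refine A'.projective_of_chain (K.subgroupOf Γ') M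
      (L := fun i : X => Subgroup.closure (x '' Set.Iic i))
      (fun i j h => Subgroup.closure_mono (Set.image_mono (Set.Iic_subset_Iic.2 h))) ?_
      (fun i => small _ (hIic i)) fun i => ?_
    · rw [← Subgroup.closure_iUnion, ← Set.image_iUnion, Set.iUnion_Iic, Set.image_univ]
      refine Eq.trans (congrArg _ (Set.ext fun y => ?_)) Subgroup.closure_closure_coe_preimage
      exact ⟨by rintro ⟨i, rfl⟩; exact i.2, fun hy => ⟨⟨y, hy⟩, rfl⟩⟩
    · have hU : ⋃ j : Set.Iio i, Set.Iic (j : X) = Set.Iio i := Set.ext fun k => by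
        simp only [Set.mem_iUnion, Set.mem_Iic, Set.mem_Iio]
        exact ⟨fun ⟨j, hj⟩ => hj.trans_lt j.2, fun hk => ⟨⟨k, hk⟩, le_rfl⟩⟩
      rw [← Subgroup.closure_iUnion, ← Set.image_iUnion, hU]
      exact small _ (hIio i)

end

end StronglyGradedRing

theorem MooreM1.subgroupOf {G : Type*} [Group G] {H Γ : Subgroup G} {x : Γ}
    (h : MooreM1 H (x : G)) : MooreM1 (H.subgroupOf Γ) x := by
  rw [MooreM1, Subgroup.ne_bot_iff_exists_ne_one] at h ⊢
  obtain ⟨⟨y, hy, hyH⟩, hy1⟩ := h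
  obtain ⟨n, rfl⟩ := Subgroup.mem_zpowers_iff.1 hy
  refine ⟨⟨x ^ n, Subgroup.zpow_mem_zpowers x n, ?_⟩, fun h1 => hy1 (Subtype.ext ?_)⟩
  · simpa [Subgroup.mem_subgroupOf] using hyH
  · simpa using congrArg (fun z => ((z : Γ) : G)) (congrArg Subtype.val h1)

theorem MooreM2.coe_subgroup {G : Type*} [Group G] {R : Type*} [Ring R] {Γ : Subgroup G} {x : Γ}
    (h : MooreM2 R (x : G)) : MooreM2 R x :=
  ⟨Submonoid.isOfFinOrder_coe.1 h.1, by rw [← Subgroup.orderOf_coe]; exact h.2⟩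

/-- The conclusion of Moore's conjecture for `(G, H, R)` follows from the conclusions for
`(Γ, H ∩ Γ, R)`, where `Γ` runs over the finitely generated subgroups of `G`. -/
theorem MooreConclusion.of_fg {G : Type w} [Group G] (H : Subgroup G) [H.FiniteIndex]
    (R : Type u) [Ring R]
    (h : ∀ Γ : Subgroup G, Γ.FG → MooreConclusion.{w, u, v, t} (H.subgroupOf Γ) R) :
    MooreConclusion.{w, u, v, t} H R := by
  intro S _ A M _ _ hM
  have := A.projective_restrict_closure H M (fun Γ hΓ => by
    refine h Γ hΓ (A.restrict Γ) (A.restrictGraded Γ) M ?_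
    have := A.projective_restrict_of_le (inf_le_left : H ⊓ Γ ≤ H) M
    rw [← Subgroup.inf_subgroupOf_right]
    exact (A.projective_restrictGraded_iff inf_le_right M).2 this) Set.univ
  rw [Subgroup.closure_univ] at this
  exact A.projective_of_projective_restrict_top M

theorem theorem1p2 (G : Type w) [Group G] :
    ((∀ Γ : Subgroup G, Γ.FG → MooreConjecture.{w, u, v, t} Γ) →
      MooreConjecture.{w, u, v, t} G) ∧
    ((∀ Γ : Subgroup G, Γ.FG → MooreConjectureOfPairs.{w, u, v, t} Γ) →
      MooreConjectureOfPairs.{w, u, v, t} G) := by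
  refine ⟨fun h H hH R _ hx => ?_, fun h H hH hx R _ => ?_⟩
  · exact MooreConclusion.of_fg H R fun Γ hΓ =>
      h Γ hΓ (H.subgroupOf Γ) inferInstance R fun x hx1 =>
        (hx x (by simpa using hx1)).imp MooreM1.subgroupOf MooreM2.coe_subgroup
  · exact MooreConclusion.of_fg H R fun Γ hΓ =>
      h Γ hΓ (H.subgroupOf Γ) inferInstance
        (fun x hx1 => (hx x (by simpa using hx1)).subgroupOf) R
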